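/- Let $\mathcal C$ be a closed, non-self-intersecting planar curve of length $L>0$, given by its regular arc-length parametrization $\mathbf v:\mathbb R\to\mathbb R^2$ (extended $L$-periodically), and assume $\mathbf v\in C^3(\mathbb R)$. Let $\mathbf n(s)$ be the unit normal at $\mathbf v(s)$, i.e. $\mathbf v'(s)$ rotated by $\pi/2$. Notation. For $p\ge 0$ the B-spline subdivision operator $S_p$ acts on (scalar or vector) sequences indexed by $\mathbb Z$ by $(S_0x)_{2i}=(S_0x)_{2i+1}=x_i$ and $(S_px)_i=\tfrac12\big((S_{p-1}x)_i+(S_{p-1}x)_{i+1}\big)$. Put $I_i=\{i,i+1,\dots,i+p+1\}$, $\Delta x_i=x_{i+1}-x_i$, $\|x\|_I=\sup_{k\in I}|x_k|$ and $\|x\|=\|x\|_{\mathbb Z}$. Normal multi-scale transform. Let $N\ge1$, and for $j\ge 0$ let $s^j=(s^j_i)_{i\in\mathbb Z}$ be real sequences. For $j\ge1$ let $\hat{\mathbf n}^j$ be sequences of directions in $\mathbb R^2$ and $d^j$ real sequences. Set $\mathbf v^j_i=\mathbf v(s^j_i)$. The $S_p$ normal multi-scale transform of $\mathcal C$ with initial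 data $\mathbf v^0$ and normals $\hat{\mathbf n}^j$ is well-posed, with arc-length sequences $s^j$, if $$\mathbf v^j=S_p\mathbf v^{j-1}+d^j\hat{\mathbf n}^j\qquad(j\ge1),$$ and for every $j\ge0$ the sequence $s^j$ is strictly increasing and satisfies $s^j_{i+2^jN}=s^j_i+L$ for all $i$. (In particular $\mathbf v^0$ consists of $N$ distinct points of $\mathcal C$, repeated periodically.) It is convergent if the piecewise linear interpolants $s^j(t)$ of $s^j$ at the grids $2^{-j}\mathbb Z$ converge, for every $t\in\mathbb R$, to a limit $s(t)$ that is continuous in $t$. The normal re-parametrization is $\boldsymbol\gamma(t)=\lim_{j\to\infty}\mathbf v^j(t)$, where $\mathbf v^j(t)$ is the piecewise linear interpolant of $\mathbf v^j$ at $2^{-j}\mathbb Z$. Theorem. Let $C_1$ be a constant. There is a constant $C>0$, depending only on $\mathcal C$ and $C_1$, such that the following holds. Let $p\ge3$, and let an $S_p$ normal multi-scale transform of $\mathcal C$ as above be well-posed and convergent. Assume that there are real numbers $\xi^j_K$ ($j\ge1$, $K\in\mathbb Z$) such that for all $j\ge1$, all $i\in\mathbb Z$ and all $K\in I_{2i}\cup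 I_{2i+1}$ $$\hat{\mathbf n}^j_K=\mathbf n(\xi^j_K),\qquad |\xi^j_K-s^{j-1}_k|\le C_1\|\Delta s^{j-1}\|_{I_i}\ \text{ for all }k\in I_i,\qquad |s^j_K-\xi^j_K|\le C_1\|\Delta s^{j-1}\|_{I_i}.$$ Then: 1. the offsets $\omega^j=s^j-S_ps^{j-1}$ satisfy $\|\omega^j\|\le C\|\Delta s^{j-1}\|^3$ for all $j\ge1$; 2. there are constants $c,c'>0$, independent of $j$, with $c\,2^{-j}\le\|\Delta s^j\|\le c'\,2^{-j}$ for all $j\ge0$; 3. the normal re-parametrization $\boldsymbol\gamma(t)$ exists for all $t\in\mathbb R$ and equals $\mathbf v(s(t))$, and both it and $s(t)$ are of class $C^{2,\alpha}$ on $\mathbb R$ for every $0<\alpha<1$ (twice continuously differentiable with uniformly $\alpha$-Hölder continuous second derivative). -/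

import Mathlib

open Set Filter Topology
open scoped NNReal

namespace NormalMT

/-- The Euclidean plane. -/
abbrev Plane : Type := EuclideanSpace ℝ (Fin 2)

/-- `v` is the arc-length parametrization, extended periodically to `ℝ`, of a regular `C¹` closed
non-self-intersecting planar curve of length `L`. -/
structure IsClosedCurve (v : ℝ → Plane) (L : ℝ) : Prop where
  length_pos : 0 < L
  periodic : Function.Periodic v L
  contDiff : ContDiff ℝ 1 v
  unit_speed : ∀ t, ‖deriv v t‖ = 1
  simple : InjOn v (Ico 0 L)

/-- The unit normal of the curve at parameter `t`: the unit tangent rotated by `π / 2`. -/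
noncomputable def normal (v : ℝ → Plane) (t : ℝ) : Plane :=
  !₂[-(deriv v t 1), deriv v t 0]

/-- The B-spline subdivision operator of degree `p`, in the Lane-Riesenfeld form
`(S₀ x)_{2i} = (S₀ x)_{2i+1} = x_i`, `(S_p x)_i = ((S_{p-1} x)_i + (S_{p-1} x)_{i+1}) / 2`.
Division of integers by `2` rounds down, so `i / 2` is the index required for `S₀`. -/
noncomputable def subdiv {E : Type*} [AddCommGroup E] [Module ℝ E] : ℕ → (ℤ → E) → ℤ → E
  | 0, x, i => x (i / 2)
  | p + 1, x, i => (2⁻¹ : ℝ) • (subdiv p x i + subdiv p x (i + 1))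

/-- The forward difference. -/
def fdiff (x : ℤ → ℝ) (i : ℤ) : ℝ := x (i + 1) - x i

/-- The supremum norm `‖x‖_I` of the sequence `x` restricted to the index set `I`. It is only used
for finite `I` and, with `I = univ`, for periodic sequences. -/
noncomputable def seqNorm (I : Set ℤ) (x : ℤ → ℝ) : ℝ := ⨆ k : I, |x k|

/-- The invariant neighbourhood `I_i = i + [0, p + 1]` of the index `i` for `S_p`. -/
def nbhd (p : ℕ) (i : ℤ) : Set ℤ := Icc i (i + (p + 1))

/-- The piecewise linear interpolant of `x` at the grid `2^{-j} ℤ`. -/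
noncomputable def interpolant {E : Type*} [AddCommGroup E] [Module ℝ E]
    (j : ℕ) (x : ℤ → E) (t : ℝ) : E :=
  (1 - Int.fract (2 ^ j * t)) • x ⌊2 ^ j * t⌋ + Int.fract (2 ^ j * t) • x (⌊2 ^ j * t⌋ + 1)

/-- The locality condition on the approximate normals `nhat` attached to the coarse arc-length
sequence `s`: `nhat_K = n(ξ_K)` with `ξ_K` close to all the `s_k` that matter for `K`. -/
def ApproxNormals (p : ℕ) (v : ℝ → Plane) (C₁ : ℝ) (s : ℤ → ℝ) (nhat : ℤ → Plane)
    (ξ : ℤ → ℝ) : Prop :=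
  ∀ i : ℤ, ∀ K ∈ nbhd p (2 * i) ∪ nbhd p (2 * i + 1),
    nhat K = normal v (ξ K) ∧ ∀ k ∈ nbhd p i, |ξ K - s k| ≤ C₁ * seqNorm (nbhd p i) (fdiff s)

/-- The additional locality condition relating the fine arc-length sequence `s'` to `ξ`. -/
def NewPointsLocal (p : ℕ) (C₁ : ℝ) (s s' : ℤ → ℝ) (ξ : ℤ → ℝ) : Prop :=
  ∀ i : ℤ, ∀ K ∈ nbhd p (2 * i) ∪ nbhd p (2 * i + 1),
    |s' K - ξ K| ≤ C₁ * seqNorm (nbhd p i) (fdiff s)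

/-- `s j` are the arc-length sequences of a well-posed `S_p` normal multi-scale transform of the
closed curve `v`, with `N` distinct initial points `v (s 0 i)`, `0 ≤ i < N`, directions `nhat` and
details `d`. Well-posed: at every level the refined points exist on the curve and are
properly ordered along it, each level `j` being a cyclic sequence of `2 ^ j * N` points. -/
structure IsWellPosedTransform (p : ℕ) (v : ℝ → Plane) (L : ℝ) (N : ℕ)
    (nhat : ℕ → ℤ → Plane) (d : ℕ → ℤ → ℝ) (s : ℕ → ℤ → ℝ) : Prop where
  one_le : 1 ≤ N
  strictMono : ∀ j, StrictMono (s j)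
  cyclic : ∀ j i, s j (i + 2 ^ j * N) = s j i + L
  step : ∀ j K, v (s (j + 1) K) =
    subdiv p (fun i => v (s j i)) K + d (j + 1) K • nhat (j + 1) K

/-- The transform converges, with arc-length limit `σ`: the limit of the arc-length interpolants
exists and is continuous. -/
structure ConvergesTo (s : ℕ → ℤ → ℝ) (σ : ℝ → ℝ) : Prop where
  continuous : Continuous σ
  tendsto : ∀ t, Tendsto (fun j => interpolant j (s j) t) atTop (𝓝 (σ t))

/-- The offsets `ω^{j+1} = s^{j+1} - S_p s^j`. -/
noncomputable def offset (p : ℕ) (s : ℕ → ℤ → ℝ) (j : ℕ) (K : ℤ) : ℝ :=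
  s (j + 1) K - subdiv p (s j) K

/-- The Hölder class `C^{k,α}`, with a uniform Hölder constant. -/
def IsHolder {E : Type*} [NormedAddCommGroup E] [NormedSpace ℝ E]
    (k : ℕ) (α : ℝ≥0) (f : ℝ → E) : Prop :=
  ContDiff ℝ k f ∧ ∃ C : ℝ≥0, HolderWith C α (iteratedDeriv k f)

end NormalMT

/-!
Put `δ_j = ‖Δs^j‖`. Three facts carry the theorem.

*Offsets.* Since the curve has unit speed, its tangential coordinate at `a` agrees with arc length
up to `O(|t - a| ^ 3)`: the derivative of the difference is `⟪v' t, v' a⟫ - 1`, which equals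
`-‖v' t - v' a‖² / 2` (`abs_inner_deriv_sub_le`). Pairing the defining relation of the transform
with the tangent at `ξ` annihilates the normal `n(ξ)`, so the new arc length is `S_p` of the old
ones up to `O(δ_j ^ 3)` (`abs_sub_subdiv_le`). The locality conditions bound all relevant distances
by a multiple of `δ_j` that does not involve `p`.

*Step sizes.* Monotone functions converging pointwise to a continuous limit converge locally
uniformly, hence `δ_j → 0` (`IsWellPosedTransform.tendsto_seqNorm_fdiff`). The first differences
obey the scheme `S_{p-1} / 2` up to the differences of the offsets, so that
`δ_{j+1} ≤ δ_j / 2 + O(δ_j ^ 3)`, and for a null sequence this forces `δ_j = O(2 ^ (-j))`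
(`exists_le_half_pow`). Conversely, the `2 ^ j N` steps of a period add up to the length.

*Smoothness.* The arc-length sequences are now generated by `S_p` up to errors `O(8 ^ (-j))`. The
divided differences of orders one, two and three follow `S_{p-1}`, `S_{p-2}` and `S_{p-3}` up to
errors `O(4 ^ (-j))`, `O(2 ^ (-j))` and `O(1)` (`NearlySubdiv.derived`). Hence the second divided
differences are bounded and the third ones grow at most linearly in `j`, which gives uniform limits
of the first and second ones, the latter with modulus of continuity `h * log (1 / h)` and therefore
`α`-Hölder for all `α < 1` (`bddHolder_of_limit`). Limits of divided differences are derivatives of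
the limit (`hasDerivAt_of_scaledDiff`). Thus the arc-length function is `C ^ {2, α}`
(`NearlySubdiv.exists_hasDerivAt`), and the chain rule transfers this to the re-parametrization.
-/

namespace NormalMT

/-! ### The subdivision operator -/

theorem subdiv_sub {E : Type*} [AddCommGroup E] [Module ℝ E] (p : ℕ) (x y : ℤ → E) (K : ℤ) :
    subdiv p (fun i => x i - y i) K = subdiv p x K - subdiv p y K := by
  induction p generalizing K with
  | zero => rfl
  | succ p ih =>
    simp only [subdiv, ih, ← smul_sub]
    congr 1
    abel

theorem subdiv_const (p : ℕ) (c : ℝ) (K : ℤ) : subdiv p (fun _ => c) K = c := by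
  induction p generalizing K with
  | zero => rfl
  | succ p ih =>
    simp only [subdiv, ih, smul_eq_mul]
    ring

theorem subdiv_map {E F : Type*} [AddCommGroup E] [Module ℝ E] [AddCommGroup F] [Module ℝ F]
    (φ : E →ₗ[ℝ] F) (p : ℕ) (x : ℤ → E) (K : ℤ) :
    subdiv p (fun i => φ (x i)) K = φ (subdiv p x K) := by
  induction p generalizing K with
  | zero => rfl
  | succ p ih => simp only [subdiv, ih, map_smul, map_add]

theorem subdiv_add_two {E : Type*} [AddCommGroup E] [Module ℝ E] (p : ℕ) (x : ℤ → E) (K : ℤ) :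
    subdiv p x (K + 2) = subdiv p (fun i => x (i + 1)) K := by
  induction p generalizing K with
  | zero =>
    simp only [subdiv]
    congr 1
    omega
  | succ p ih =>
    simp only [subdiv]
    rw [ih K, show K + 2 + 1 = K + 1 + 2 by ring, ih (K + 1)]

/-- The derived scheme of `S_{p+1}` is `S_p / 2`. -/
theorem fdiff_subdiv_succ (p : ℕ) (x : ℤ → ℝ) (K : ℤ) :
    fdiff (subdiv (p + 1) x) K = 2⁻¹ * subdiv p (fdiff x) K := by
  have h : subdiv p (fdiff x) K = subdiv p (fun i => x (i + 1)) K - subdiv p x K :=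
    subdiv_sub p (fun i => x (i + 1)) x K
  rw [h, ← subdiv_add_two]
  simp only [fdiff, subdiv, smul_eq_mul, add_assoc]
  norm_num
  ring

/-- `(S_p x)_K` is an average of the `x_k` with `⌊K / 2⌋ ≤ k ≤ ⌊(K + p) / 2⌋`. -/
theorem abs_subdiv_le {p : ℕ} {x : ℤ → ℝ} {K : ℤ} {c : ℝ}
    (h : ∀ k, K / 2 ≤ k → k ≤ (K + p) / 2 → |x k| ≤ c) : |subdiv p x K| ≤ c := by
  induction p generalizing K with
  | zero => exact h _ le_rfl (by simp)
  | succ p ih =>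
    have h1 : |subdiv p x K| ≤ c := ih fun k hk hk' => h k hk (by push_cast; omega)
    have h2 : |subdiv p x (K + 1)| ≤ c :=
      ih fun k hk hk' => h k (by omega) (by push_cast; omega)
    rw [abs_le] at h1 h2 ⊢
    simp only [subdiv, smul_eq_mul]
    constructor <;> linarith

theorem abs_subdiv_sub_le {x : ℤ → ℝ} {δ : ℝ} (h : ∀ k, |fdiff x k| ≤ δ) (p : ℕ) (K : ℤ) :
    |subdiv p x K - x (K / 2)| ≤ p * δ := by
  induction p generalizing K with
  | zero => simp [subdiv]
  | succ p ih =>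
    have h1 := ih K
    have h2 := ih (K + 1)
    have h3 : |x ((K + 1) / 2) - x (K / 2)| ≤ δ := by
      rcases Int.emod_two_eq_zero_or_one K with hK | hK
      · rw [show (K + 1) / 2 = K / 2 by omega, sub_self, abs_zero]
        exact (abs_nonneg _).trans (h 0)
      · rw [show (K + 1) / 2 = K / 2 + 1 by omega]
        exact h _
    have h4 := (abs_nonneg _).trans (h 0)
    rw [abs_le] at h1 h2 h3 ⊢
    simp only [subdiv, smul_eq_mul]
    push_cast
    constructor <;> linarith

/-! ### Nearly linear subdivision -/

/-- The sequences `x j` are generated by `S_q` up to an error of at most `A * r ^ j` in the step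
from level `j` to level `j + 1`. -/
def NearlySubdiv (q : ℕ) (x : ℕ → ℤ → ℝ) (A r : ℝ) : Prop :=
  ∀ j K, |x (j + 1) K - subdiv q (x j) K| ≤ A * r ^ j

/-- The divided differences of the sequences `x j`, regarded as samples on the grids
`2 ^ (-j) * ℤ`. -/
def scaledDiff (x : ℕ → ℤ → ℝ) (j : ℕ) (k : ℤ) : ℝ := 2 ^ j * fdiff (x j) k

theorem subdiv_const_mul (p : ℕ) (c : ℝ) (x : ℤ → ℝ) (K : ℤ) :
    subdiv p (fun i => c * x i) K = c * subdiv p x K :=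
  subdiv_map (LinearMap.mulLeft ℝ c) p x K

/-- Each divided difference lowers the degree of the scheme by one, at the price of a factor `2`
in the decay rate of the errors. -/
theorem NearlySubdiv.derived {q : ℕ} {x : ℕ → ℤ → ℝ} {A r : ℝ}
    (h : NearlySubdiv (q + 1) x A r) : NearlySubdiv q (scaledDiff x) (4 * A) (2 * r) := by
  intro j K
  have h1 : scaledDiff x (j + 1) K - subdiv q (scaledDiff x j) K =
      2 ^ (j + 1) * ((x (j + 1) (K + 1) - subdiv (q + 1) (x j) (K + 1)) -
        (x (j + 1) K - subdiv (q + 1) (x j) K)) := by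
    have h2 : subdiv q (scaledDiff x j) K = 2 ^ j * subdiv q (fdiff (x j)) K :=
      subdiv_const_mul q _ _ K
    have h3 := fdiff_subdiv_succ q (x j) K
    rw [h2, show subdiv q (fdiff (x j)) K = 2 * fdiff (subdiv (q + 1) (x j)) K by
      rw [h3]; ring]
    simp only [scaledDiff, fdiff]
    ring
  rw [h1, abs_mul, abs_of_pos (by positivity)]
  calc _ ≤ (2 : ℝ) ^ (j + 1) * (A * r ^ j + A * r ^ j) := by
        gcongr
        exact (abs_sub _ _).trans (add_le_add (h j (K + 1)) (h j K))
    _ = _ := by rw [mul_pow]; ring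

theorem NearlySubdiv.abs_le_sum {q : ℕ} {x : ℕ → ℤ → ℝ} {A r B : ℝ}
    (h : NearlySubdiv q x A r) (h0 : ∀ k, |x 0 k| ≤ B) (j : ℕ) (k : ℤ) :
    |x j k| ≤ B + ∑ i ∈ Finset.range j, A * r ^ i := by
  induction j generalizing k with
  | zero => simpa using h0 k
  | succ j ih =>
    rw [Finset.sum_range_succ, ← add_assoc]
    have h1 : |subdiv q (x j) k| ≤ _ := abs_subdiv_le fun k _ _ => ih k
    have h2 := abs_add_le (x (j + 1) k - subdiv q (x j) k) (subdiv q (x j) k)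
    rw [sub_add_cancel] at h2
    linarith [h j k]

theorem NearlySubdiv.abs_le_of_lt_one {q : ℕ} {x : ℕ → ℤ → ℝ} {A r B : ℝ} (hA : 0 ≤ A) (hr : 0 ≤ r)
    (hr1 : r < 1) (h : NearlySubdiv q x A r) (h0 : ∀ k, |x 0 k| ≤ B) (j : ℕ) (k : ℤ) :
    |x j k| ≤ B + A * (1 - r)⁻¹ := by
  refine (h.abs_le_sum h0 j k).trans ?_
  rw [← Finset.mul_sum, ← tsum_geometric_of_lt_one hr hr1]
  gcongr
  exact (summable_geometric_of_lt_one hr hr1).sum_le_tsum _ fun i _ => by positivity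

theorem NearlySubdiv.mono {q : ℕ} {x : ℕ → ℤ → ℝ} {A A' r r' : ℝ} (h : NearlySubdiv q x A r)
    (hA : 0 ≤ A) (hAA' : A ≤ A') (hr : 0 ≤ r) (hrr' : r ≤ r') : NearlySubdiv q x A' r' :=
  fun j K => (h j K).trans <| by
    have := hA.trans hAA'
    gcongr

theorem abs_fdiff_le_of_scaledDiff {x : ℕ → ℤ → ℝ} {j : ℕ} {k : ℤ} {B : ℝ}
    (h : |scaledDiff x j k| ≤ B) : |fdiff (x j) k| ≤ B * (1 / 2) ^ j := by
  rw [scaledDiff, abs_mul, abs_of_pos (by positivity)] at h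
  rw [one_div, inv_pow, ← div_eq_mul_inv, le_div_iff₀ (by positivity)]
  linarith

/-! ### Limit functions and their regularity -/

theorem floor_two_pow_succ_mul_ediv (j : ℕ) (t : ℝ) :
    ⌊(2 : ℝ) ^ (j + 1) * t⌋ / 2 = ⌊(2 : ℝ) ^ j * t⌋ := by
  have h := Int.floor_div_natCast ((2 : ℝ) ^ (j + 1) * t) 2
  push_cast at h
  rw [← h]
  congr 1
  ring

/-- A nearly linear subdivision process whose errors and differences decay geometrically
converges uniformly at the same rate. -/
theorem NearlySubdiv.exists_limit {q : ℕ} {x : ℕ → ℤ → ℝ} {A r : ℝ} (hr1 : r < 1)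
    (h : NearlySubdiv q x A r) (hd : ∀ j k, |fdiff (x j) k| ≤ A * r ^ j) :
    ∃ (g : ℝ → ℝ) (B : ℝ), ∀ j t, |x j ⌊(2 : ℝ) ^ j * t⌋ - g t| ≤ B * r ^ j := by
  have hstep : ∀ t j, dist (x j ⌊(2 : ℝ) ^ j * t⌋) (x (j + 1) ⌊(2 : ℝ) ^ (j + 1) * t⌋) ≤
      ((q + 1) * A) * r ^ j := by
    intro t j
    have h1 := h j ⌊(2 : ℝ) ^ (j + 1) * t⌋
    have h2 := abs_subdiv_sub_le (hd j) q ⌊(2 : ℝ) ^ (j + 1) * t⌋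
    rw [floor_two_pow_succ_mul_ediv] at h2
    rw [dist_comm, Real.dist_eq]
    have h3 := abs_add_le _ _ |>.trans (add_le_add h1 h2)
    rw [sub_add_sub_cancel] at h3
    linarith
  have hlim : ∀ t, ∃ a, Tendsto (fun j => x j ⌊(2 : ℝ) ^ j * t⌋) atTop (𝓝 a) := fun t =>
    cauchySeq_tendsto_of_complete (cauchySeq_of_le_geometric r _ hr1 (hstep t))
  choose g hg using hlim
  refine ⟨g, (q + 1) * A / (1 - r), fun j t => ?_⟩
  rw [← Real.dist_eq]
  refine (dist_le_of_le_geometric_of_tendsto r _ hr1 (hstep t) (hg t) j).trans_eq ?_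
  ring

theorem abs_sub_sub_mul_le {x : ℤ → ℝ} {c ε : ℝ} {a b : ℤ} (hab : a ≤ b)
    (h : ∀ k, a ≤ k → k < b → |fdiff x k - c| ≤ ε) :
    |x b - x a - c * (b - a)| ≤ ε * (b - a) := by
  induction b, hab using Int.leInduction with
  | base => simp
  | succ b hab ih =>
    have h1 := ih fun k hk hk' => h k hk (by omega)
    have h2 := h b hab (by omega)
    simp only [fdiff] at h2
    rw [abs_le] at h1 h2 ⊢
    push_cast
    constructor <;> linarith

theorem tendsto_floor_two_pow_mul_div (t : ℝ) :
    Tendsto (fun j : ℕ => (⌊(2 : ℝ) ^ j * t⌋ : ℝ) / 2 ^ j) atTop (𝓝 t) := by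
  have h0 : Tendsto (fun j : ℕ => (1 / 2 : ℝ) ^ j) atTop (𝓝 0) :=
    tendsto_pow_atTop_nhds_zero_of_lt_one (by norm_num) (by norm_num)
  have h1 : Tendsto (fun j : ℕ => t - (1 / 2 : ℝ) ^ j) atTop (𝓝 t) := by
    simpa using h0.const_sub t
  refine tendsto_of_tendsto_of_tendsto_of_le_of_le h1 tendsto_const_nhds (fun j => ?_)
    fun j => ?_
  · have := Int.sub_one_lt_floor ((2 : ℝ) ^ j * t)
    have h2 : (0 : ℝ) < 2 ^ j := by positivity
    rw [le_div_iff₀ h2, sub_mul, ← mul_pow]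
    norm_num
    linarith
  · have := Int.floor_le ((2 : ℝ) ^ j * t)
    have h2 : (0 : ℝ) < 2 ^ j := by positivity
    rw [div_le_iff₀ h2]
    linarith

/-- If the samples `x j` converge to `f` and their divided differences converge uniformly to a
continuous `g`, then `f` is a primitive of `g`. -/
theorem hasDerivAt_of_scaledDiff {x : ℕ → ℤ → ℝ} {f g : ℝ → ℝ} {e : ℕ → ℝ}
    (hf : ∀ t, Tendsto (fun j => x j ⌊(2 : ℝ) ^ j * t⌋) atTop (𝓝 (f t)))
    (he : Tendsto e atTop (𝓝 0))
    (hg : ∀ j t, |scaledDiff x j ⌊(2 : ℝ) ^ j * t⌋ - g t| ≤ e j) (hgc : Continuous g) (u : ℝ) :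
    HasDerivAt f (g u) u := by
  -- `f` is within `ε` of the affine function of slope `g u` on intervals near `u`
  have key : ∀ ε > 0, ∃ δ > 0, ∀ a b, |a - u| < δ → |b - u| < δ → a ≤ b →
      |f b - f a - g u * (b - a)| ≤ ε * (b - a) := by
    intro ε hε
    obtain ⟨δ, hδ, hδ'⟩ := Metric.continuousAt_iff.1 (hgc.continuousAt (x := u)) (ε / 2)
      (by positivity)
    refine ⟨δ / 2, by positivity, fun a b ha hb hab => ?_⟩
    have hfl : ∀ j : ℕ, ⌊(2 : ℝ) ^ j * a⌋ ≤ ⌊(2 : ℝ) ^ j * b⌋ := fun j =>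
      Int.floor_mono (by gcongr)
    have h1 : ∀ᶠ j : ℕ in atTop, e j < ε / 2 := he.eventually (gt_mem_nhds (by positivity))
    have h2 : ∀ᶠ j : ℕ in atTop, (1 / 2 : ℝ) ^ j < δ / 2 :=
      (tendsto_pow_atTop_nhds_zero_of_lt_one (by norm_num) (by norm_num)).eventually
        (gt_mem_nhds (by positivity))
    have h3 : ∀ᶠ j : ℕ in atTop,
        |x j ⌊(2 : ℝ) ^ j * b⌋ - x j ⌊(2 : ℝ) ^ j * a⌋ -
          g u * ((⌊(2 : ℝ) ^ j * b⌋ : ℝ) / 2 ^ j - (⌊(2 : ℝ) ^ j * a⌋ : ℝ) / 2 ^ j)| ≤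
          ε * ((⌊(2 : ℝ) ^ j * b⌋ : ℝ) / 2 ^ j - (⌊(2 : ℝ) ^ j * a⌋ : ℝ) / 2 ^ j) := by
      filter_upwards [h1, h2] with j hj1 hj2
      have hp : (0 : ℝ) < 2 ^ j := by positivity
      have := abs_sub_sub_mul_le (x := x j) (c := g u / 2 ^ j) (ε := ε / 2 ^ j) (hfl j) ?_
      · calc _ = |x j ⌊(2 : ℝ) ^ j * b⌋ - x j ⌊(2 : ℝ) ^ j * a⌋ -
            g u / 2 ^ j * (⌊(2 : ℝ) ^ j * b⌋ - ⌊(2 : ℝ) ^ j * a⌋)| := by congr 1; ring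
          _ ≤ _ := this
          _ = _ := by ring
      intro k hk hk'
      have hk1 : (2 : ℝ) ^ j * a < k + 1 := by
        exact_mod_cast (Int.lt_floor_add_one _).trans_le
          (by exact_mod_cast Int.add_le_add_right hk 1)
      have hk2 : (k : ℝ) ≤ 2 ^ j * b := Int.le_floor.1 hk'.le
      have hk3 : |(k : ℝ) / 2 ^ j - u| < δ := by
        have e1 : a - (1 / 2) ^ j < (k : ℝ) / 2 ^ j := by
          rw [lt_div_iff₀ hp, sub_mul, ← mul_pow]
          norm_num
          linarith
        have e2 : (k : ℝ) / 2 ^ j ≤ b := by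
          rw [div_le_iff₀ hp]
          linarith
        rw [abs_lt] at ha hb ⊢
        constructor <;> linarith
      have hk4 := hδ' hk3
      rw [Real.dist_eq] at hk4
      have hk5 := hg j ((k : ℝ) / 2 ^ j)
      rw [mul_div_cancel₀ _ hp.ne', Int.floor_intCast] at hk5
      have hk6 : |scaledDiff x j k - g u| ≤ ε := by
        rw [abs_le] at hk5 ⊢
        rw [abs_lt] at hk4
        constructor <;> linarith
      rw [scaledDiff] at hk6
      have hk7 : fdiff (x j) k - g u / 2 ^ j = (2 ^ j * fdiff (x j) k - g u) / 2 ^ j := by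
        field_simp
      rw [hk7, abs_div, abs_of_pos hp]
      gcongr
    have t1 := tendsto_floor_two_pow_mul_div a
    have t2 := tendsto_floor_two_pow_mul_div b
    exact le_of_tendsto_of_tendsto
      ((((hf b).sub (hf a)).sub ((t2.sub t1).const_mul (g u))).abs) ((t2.sub t1).const_mul ε) h3
  rw [hasDerivAt_iff_isLittleO, Asymptotics.isLittleO_iff]
  intro ε hε
  obtain ⟨δ, hδ, hδ'⟩ := key ε hε
  filter_upwards [Metric.ball_mem_nhds u hδ] with t ht
  rw [Metric.mem_ball, Real.dist_eq] at ht
  have hu : |u - u| < δ := by simpa using hδ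
  simp only [Real.norm_eq_abs, smul_eq_mul]
  rcases le_total u t with htu | htu
  · rw [abs_of_nonneg (sub_nonneg.2 htu), mul_comm (t - u)]
    exact hδ' u t hu ht htu
  · have := hδ' t u ht hu htu
    rw [abs_sub_comm t u, abs_of_nonneg (sub_nonneg.2 htu)]
    rw [← abs_neg]
    convert this using 2
    ring

/-! ### Bounded Hölder continuous functions -/

/-- `f` is bounded and `α`-Hölder continuous. The Hölder estimate is only required at distances up
to `1`, since boundedness provides it at larger ones; in this form Lipschitz continuity implies
it directly for every `α ≤ 1`. -/
def BddHolder {E : Type*} [NormedAddCommGroup E] (α : ℝ) (f : ℝ → E) : Prop :=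
  ∃ A : ℝ, 0 ≤ A ∧ (∀ t, ‖f t‖ ≤ A) ∧ ∀ t u, |t - u| ≤ 1 → ‖f t - f u‖ ≤ A * |t - u| ^ α

theorem BddHolder.add {E : Type*} [NormedAddCommGroup E] {α : ℝ} {f g : ℝ → E}
    (hf : BddHolder α f) (hg : BddHolder α g) :
    BddHolder α fun t => f t + g t := by
  obtain ⟨A, hA, hfA, hfA'⟩ := hf
  obtain ⟨B, hB, hgB, hgB'⟩ := hg
  refine ⟨A + B, by positivity, fun t => (norm_add_le _ _).trans (add_le_add (hfA t) (hgB t)),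
    fun t u htu => ?_⟩
  rw [add_sub_add_comm, add_mul]
  exact (norm_add_le _ _).trans (add_le_add (hfA' t u htu) (hgB' t u htu))

theorem BddHolder.smul {E : Type*} [NormedAddCommGroup E] [NormedSpace ℝ E] {α : ℝ}
    {f : ℝ → ℝ} {g : ℝ → E} (hf : BddHolder α f) (hg : BddHolder α g) :
    BddHolder α fun t => f t • g t := by
  obtain ⟨A, hA, hfA, hfA'⟩ := hf
  obtain ⟨B, hB, hgB, hgB'⟩ := hg
  refine ⟨2 * (A * B), by positivity, fun t => ?_, fun t u htu => ?_⟩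
  · rw [norm_smul]
    calc ‖f t‖ * ‖g t‖ ≤ A * B := by gcongr <;> [exact hfA t; exact hgB t]
      _ ≤ 2 * (A * B) := by linarith [mul_nonneg hA hB]
  · have h1 : f t • g t - f u • g u = (f t - f u) • g t + f u • (g t - g u) := by
      rw [sub_smul, smul_sub]
      abel
    rw [h1]
    calc _ ≤ ‖f t - f u‖ * ‖g t‖ + ‖f u‖ * ‖g t - g u‖ := by
          rw [← norm_smul, ← norm_smul]
          exact norm_add_le _ _
      _ ≤ (A * |t - u| ^ α) * B + A * (B * |t - u| ^ α) := by
          gcongr <;> [exact hfA' t u htu; exact hgB t; exact hfA u; exact hgB' t u htu]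
      _ = _ := by ring

theorem BddHolder.of_hasDerivAt {E : Type*} [NormedAddCommGroup E] [NormedSpace ℝ E] {α : ℝ}
    (hα : α ≤ 1) {f f' : ℝ → E} {A B : ℝ} (hf : ∀ t, ‖f t‖ ≤ A)
    (hd : ∀ t, HasDerivAt f (f' t) t) (hB : ∀ t, ‖f' t‖ ≤ B) : BddHolder α f := by
  have hB0 : 0 ≤ B := (norm_nonneg _).trans (hB 0)
  have hA0 : 0 ≤ A := (norm_nonneg _).trans (hf 0)
  refine ⟨A + B, by positivity, fun t => (hf t).trans (by linarith), fun t u htu => ?_⟩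
  have h1 := convex_univ.norm_image_sub_le_of_norm_hasDerivWithin_le
    (fun x _ => (hd x).hasDerivWithinAt) (fun x _ => hB x) (mem_univ u) (mem_univ t)
  have h2 : |t - u| ≤ |t - u| ^ α := by
    rcases (abs_nonneg (t - u)).eq_or_lt with h0 | h0
    · rw [← h0]
      positivity
    · simpa using Real.rpow_le_rpow_of_exponent_ge h0 htu hα
  calc _ ≤ B * |t - u| := h1
    _ ≤ (A + B) * |t - u| ^ α := by gcongr; linarith

theorem BddHolder.holderWith {E : Type*} [NormedAddCommGroup E] {α : ℝ≥0} {f : ℝ → E}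
    (hf : BddHolder α f) :
    ∃ C : ℝ≥0, HolderWith C α f := by
  obtain ⟨A, hA, hb, hh⟩ := hf
  refine ⟨(2 * A).toNNReal, fun t u => ?_⟩
  have h1 : dist (f t) (f u) ≤ 2 * A * dist t u ^ (α : ℝ) := by
    rw [dist_eq_norm, Real.dist_eq]
    rcases le_total |t - u| 1 with htu | htu
    · refine (hh t u htu).trans ?_
      gcongr
      linarith
    · have h2 : 1 ≤ |t - u| ^ (α : ℝ) := Real.one_le_rpow htu α.coe_nonneg
      calc _ ≤ ‖f t‖ + ‖f u‖ := norm_sub_le _ _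
        _ ≤ 2 * A * 1 := by linarith [hb t, hb u]
        _ ≤ _ := by gcongr
  change _ ≤ ENNReal.ofReal (2 * A) * _
  rw [edist_dist, edist_dist, ENNReal.ofReal_rpow_of_nonneg dist_nonneg α.coe_nonneg,
    ← ENNReal.ofReal_mul (by positivity)]
  exact ENNReal.ofReal_le_ofReal h1

theorem isHolder_two {E : Type*} [NormedAddCommGroup E] [NormedSpace ℝ E] {α : ℝ≥0}
    (hα : 0 < α) {f f' f'' : ℝ → E} (hf : ∀ t, HasDerivAt f (f' t) t)
    (hf' : ∀ t, HasDerivAt f' (f'' t) t) (hh : BddHolder α f'') : IsHolder 2 α f := by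
  obtain ⟨C, hC⟩ := hh.holderWith
  have e1 : deriv f = f' := funext fun t => (hf t).deriv
  have e2 : deriv f' = f'' := funext fun t => (hf' t).deriv
  refine ⟨?_, C, ?_⟩
  · have h1 : ContDiff ℝ 1 f' :=
      contDiff_one_iff_deriv.2 ⟨fun t => (hf' t).differentiableAt, by
        rw [e2]
        exact hC.continuous hα⟩
    have h2 : ContDiff ℝ (1 + 1) f :=
      contDiff_succ_iff_deriv.2 ⟨fun t => (hf t).differentiableAt, by simp, by rwa [e1]⟩
    exact_mod_cast h2
  · rwa [iteratedDeriv_succ, iteratedDeriv_one, e1, e2]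

/-- The limit of a subdivision process whose differences at level `j` are `O(2 ^ (-α j))` is
`α`-Hölder: compare `g t` and `g u` through the samples at the level `j` with
`2 ^ (-j) ≈ |t - u|`, where the samples next to `t` and `u` are at most one index apart. -/
theorem bddHolder_of_limit {x : ℕ → ℤ → ℝ} {g : ℝ → ℝ} {A B M α : ℝ} (hα : 0 < α)
    (hM : ∀ k, |x 0 k| ≤ M) (hd : ∀ j k, |fdiff (x j) k| ≤ A * ((1 / 2 : ℝ) ^ α) ^ j)
    (hlim : ∀ j t, |x j ⌊(2 : ℝ) ^ j * t⌋ - g t| ≤ B * ((1 / 2 : ℝ) ^ α) ^ j) :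
    BddHolder α g := by
  have hA : 0 ≤ A := by simpa using (abs_nonneg _).trans (hd 0 0)
  have hB : 0 ≤ B := by simpa using (abs_nonneg _).trans (hlim 0 0)
  have hM0 : 0 ≤ M := (abs_nonneg _).trans (hM 0)
  have main : ∀ t u, |t - u| ≤ 1 → u < t → |g t - g u| ≤ (A + 2 * B) * 2 ^ α * |t - u| ^ α := by
    intro t u htu hut
    obtain ⟨j, hj1, hj2⟩ := exists_nat_pow_near_of_lt_one (abs_pos.2 (sub_pos.2 hut).ne') htu
      (show (0 : ℝ) < 1 / 2 by norm_num) (by norm_num)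
    rw [abs_of_pos (sub_pos.2 hut)] at *
    have hp : (0 : ℝ) < 2 ^ j := by positivity
    have hle : ⌊(2 : ℝ) ^ j * u⌋ ≤ ⌊(2 : ℝ) ^ j * t⌋ := Int.floor_mono (by gcongr)
    have hle' : ⌊(2 : ℝ) ^ j * t⌋ ≤ ⌊(2 : ℝ) ^ j * u⌋ + 1 := by
      rw [← Int.floor_add_one]
      apply Int.floor_mono
      rw [one_div, inv_pow, ← one_div, le_div_iff₀ hp] at hj2
      linarith
    have h1 : |x j ⌊(2 : ℝ) ^ j * t⌋ - x j ⌊(2 : ℝ) ^ j * u⌋| ≤ A * ((1 / 2 : ℝ) ^ α) ^ j := by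
      rcases hle.eq_or_lt with h | h
      · rw [h, sub_self, abs_zero]
        positivity
      · rw [show ⌊(2 : ℝ) ^ j * t⌋ = ⌊(2 : ℝ) ^ j * u⌋ + 1 by omega]
        exact hd j _
    have h2 := hlim j t
    have h3 := hlim j u
    have h4 : |g t - g u| ≤ (A + 2 * B) * ((1 / 2 : ℝ) ^ α) ^ j := by
      rw [abs_le] at h1 h2 h3 ⊢
      constructor <;> linarith
    have h5 : ((1 / 2 : ℝ) ^ α) ^ j ≤ 2 ^ α * (t - u) ^ α := by
      rw [← Real.mul_rpow (by norm_num) (sub_pos.2 hut).le, ← Real.rpow_natCast,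
        ← Real.rpow_mul (by norm_num), mul_comm α, Real.rpow_mul (by norm_num),
        Real.rpow_natCast]
      gcongr
      rw [pow_succ] at hj1
      linarith
    calc _ ≤ _ := h4
      _ ≤ (A + 2 * B) * (2 ^ α * (t - u) ^ α) := by gcongr
      _ = _ := by ring
  refine ⟨(A + 2 * B) * 2 ^ α + (M + B), by positivity, fun t => ?_, fun t u htu => ?_⟩
  · have h1 : |x 0 ⌊(2 : ℝ) ^ 0 * t⌋ - g t| ≤ B := by simpa using hlim 0 t
    have h2 := hM ⌊(2 : ℝ) ^ 0 * t⌋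
    have h3 : 0 ≤ (A + 2 * B) * 2 ^ α := by positivity
    rw [abs_le] at h1 h2
    rw [Real.norm_eq_abs, abs_le]
    constructor <;> linarith
  · have h3 : 0 ≤ (M + B) * |t - u| ^ α := by positivity
    rw [Real.norm_eq_abs, add_mul]
    rcases lt_trichotomy u t with h | h | h
    · linarith [main t u htu h]
    · rw [h, sub_self, abs_zero]
      positivity
    · have := main u t (by rwa [abs_sub_comm]) h
      rw [abs_sub_comm, abs_sub_comm u] at this
      linarith

/-! ### Smoothness of the limit -/

theorem exists_add_one_mul_pow_le {r : ℝ} (hr : 1 / 2 < r) :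
    ∃ B : ℝ, ∀ j : ℕ, (j + 1) * (1 / 2 : ℝ) ^ j ≤ B * r ^ j := by
  have hr0 : 0 < r := by linarith
  have h1 : 1 / 2 / r < 1 := (div_lt_one hr0).2 hr
  have h2 := (tendsto_self_mul_const_pow_of_lt_one (by positivity) h1).add
    (tendsto_pow_atTop_nhds_zero_of_lt_one (by positivity) h1)
  obtain ⟨B, hB⟩ := h2.bddAbove_range
  refine ⟨B, fun j => ?_⟩
  have h3 := hB (mem_range_self j)
  simp only [div_pow _ r] at h3
  rw [← add_one_mul, ← mul_div_assoc, div_le_iff₀ (by positivity)] at h3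
  exact h3

/-- A nearly linear subdivision process of degree at least `3` with errors `O(8 ^ (-j))` has a
`C ^ {2, α}` limit for every `α < 1`. The third divided differences need not be bounded, but they
grow at most linearly in `j`, so that the differences of the second divided differences are
`O(j * 2 ^ (-j))`. -/
theorem NearlySubdiv.exists_hasDerivAt {p : ℕ} (hp : 3 ≤ p) {x : ℕ → ℤ → ℝ} {f : ℝ → ℝ}
    {A D : ℝ} (h : NearlySubdiv p x A (1 / 8)) (hD : ∀ k, |fdiff (x 0) k| ≤ D)
    (hf : ∀ t, Tendsto (fun j => x j ⌊(2 : ℝ) ^ j * t⌋) atTop (𝓝 (f t)))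
    {α : ℝ} (hα : 0 < α) (hα1 : α < 1) :
    ∃ f' f'' : ℝ → ℝ, (∀ t, HasDerivAt f (f' t) t) ∧ (∀ t, HasDerivAt f' (f'' t) t) ∧
      (∃ B, ∀ t, |f' t| ≤ B) ∧ BddHolder α f'' := by
  obtain ⟨q, rfl⟩ : ∃ q, p = q + 3 := ⟨p - 3, by omega⟩
  have hA : 0 ≤ A := by simpa using (abs_nonneg _).trans (h 0 0)
  have h1 := h.derived
  have h2 := h1.derived
  have h3 := h2.derived
  norm_num at h1 h2 h3
  have d1 : ∀ k, |scaledDiff x 0 k| ≤ D := by simpa [scaledDiff] using hD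
  have d2 : ∀ k, |scaledDiff (scaledDiff x) 0 k| ≤ 2 * D := fun k => by
    simp only [scaledDiff, pow_zero, one_mul, fdiff] at d1 ⊢
    exact (abs_sub _ _).trans (by linarith [d1 k, d1 (k + 1)])
  have d3 : ∀ k, |scaledDiff (scaledDiff (scaledDiff x)) 0 k| ≤
      4 * D := fun k => by
    have e : ∀ k, scaledDiff (scaledDiff (scaledDiff x)) 0 k =
      scaledDiff (scaledDiff x) 0 (k + 1) -
        scaledDiff (scaledDiff x) 0 k := fun k => by
      conv_lhs => rw [scaledDiff, pow_zero, one_mul, fdiff]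
    rw [e]
    exact (abs_sub _ _).trans (by linarith [d2 k, d2 (k + 1)])
  have hD0 : 0 ≤ D := (abs_nonneg _).trans (hD 0)
  obtain ⟨B₂, hB₂0, hB₂⟩ : ∃ B, 0 ≤ B ∧
      ∀ j k, |scaledDiff (scaledDiff x) j k| ≤ B :=
    ⟨_, by norm_num; positivity,
      h2.abs_le_of_lt_one (by positivity) (by norm_num) (by norm_num) d2⟩
  obtain ⟨f', C₁, hf'⟩ := (h1.mono (A' := 4 * A + B₂) (r' := 1 / 2) (by positivity)
    (by linarith) (by norm_num) (by norm_num)).exists_limit (by norm_num) fun j k =>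
      (abs_fdiff_le_of_scaledDiff (hB₂ j k)).trans (by gcongr; linarith)
  -- the rate `j * 2 ^ (-j)` is absorbed into `r ^ j` with `r = 2 ^ (-α) > 1 / 2`
  have hr : (1 / 2 : ℝ) < (1 / 2) ^ α := by
    simpa using Real.rpow_lt_rpow_of_exponent_gt (show (0 : ℝ) < 1 / 2 by norm_num) (by norm_num)
      hα1
  have hr1 : (1 / 2 : ℝ) ^ α < 1 := Real.rpow_lt_one (by norm_num) (by norm_num) hα
  obtain ⟨B₃, hB₃⟩ := exists_add_one_mul_pow_le hr
  have hB₃0 : 0 ≤ B₃ := by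
    have := hB₃ 0
    norm_num at this
    linarith
  have hd3 : ∀ j k, |fdiff (scaledDiff (scaledDiff x) j) k| ≤
      (4 * D + 64 * A) * B₃ * ((1 / 2 : ℝ) ^ α) ^ j := fun j k => by
    have e1 := h3.abs_le_sum d3 j k
    have e2 : |scaledDiff (scaledDiff (scaledDiff x)) j k| ≤
        (4 * D + 64 * A) * (j + 1) := by
      simp only [one_pow, mul_one, Finset.sum_const, Finset.card_range, nsmul_eq_mul] at e1
      nlinarith [mul_nonneg hD0 (Nat.cast_nonneg' (α := ℝ) j)]
    calc _ ≤ _ := abs_fdiff_le_of_scaledDiff e2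
      _ = (4 * D + 64 * A) * ((j + 1) * (1 / 2 : ℝ) ^ j) := by ring
      _ ≤ (4 * D + 64 * A) * (B₃ * ((1 / 2 : ℝ) ^ α) ^ j) :=
          mul_le_mul_of_nonneg_left (hB₃ j) (by positivity)
      _ = _ := by ring
  obtain ⟨f'', C₂, hf''⟩ := (h2.mono (A' := 16 * A + (4 * D + 64 * A) * B₃)
    (r' := (1 / 2 : ℝ) ^ α) (by positivity)
      (by linarith [show 0 ≤ (4 * D + 64 * A) * B₃ by positivity]) (by norm_num)
      (by simpa using hr.le)).exists_limit hr1 fun j k =>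
        (hd3 j k).trans (by gcongr; linarith)
  have hHol : BddHolder α f'' := bddHolder_of_limit hα d2 hd3 hf''
  have hcont'' : Continuous f'' := by
    obtain ⟨C, hC⟩ := BddHolder.holderWith (α := ⟨α, hα.le⟩) hHol
    exact hC.continuous hα
  have hlim' : ∀ t, Tendsto (fun j => scaledDiff x j ⌊(2 : ℝ) ^ j * t⌋) atTop
      (𝓝 (f' t)) := fun t => by
    rw [tendsto_iff_norm_sub_tendsto_zero]
    refine squeeze_zero (fun _ => norm_nonneg _) (fun j => hf' j t) ?_
    simpa using (tendsto_pow_atTop_nhds_zero_of_lt_one (show (0 : ℝ) ≤ 1 / 2 by norm_num)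
      (by norm_num)).const_mul C₁
  have hder' : ∀ t, HasDerivAt f' (f'' t) t := hasDerivAt_of_scaledDiff hlim'
    (by simpa using (tendsto_pow_atTop_nhds_zero_of_lt_one (by positivity) hr1).const_mul C₂)
    hf'' hcont''
  have hder : ∀ t, HasDerivAt f (f' t) t := hasDerivAt_of_scaledDiff hf
    (by simpa using (tendsto_pow_atTop_nhds_zero_of_lt_one (show (0 : ℝ) ≤ 1 / 2 by norm_num)
      (by norm_num)).const_mul C₁) hf'
    (continuous_iff_continuousAt.2 fun t => (hder' t).continuousAt)
  refine ⟨f', f'', hder, hder', ⟨D + C₁, fun t => ?_⟩, hHol⟩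
  have e1 : |scaledDiff x 0 ⌊(2 : ℝ) ^ 0 * t⌋ - f' t| ≤ C₁ := by simpa using hf' 0 t
  have e2 := d1 ⌊(2 : ℝ) ^ 0 * t⌋
  rw [abs_le] at e1 e2 ⊢
  constructor <;> linarith

/-! ### Supremum norms -/

theorem seqNorm_le {I : Set ℤ} (hI : I.Nonempty) {x : ℤ → ℝ} {c : ℝ} (h : ∀ k ∈ I, |x k| ≤ c) :
    seqNorm I x ≤ c :=
  haveI := hI.to_subtype
  ciSup_le fun k => h k k.2

theorem abs_le_seqNorm {x : ℤ → ℝ} {c : ℝ} (h : ∀ k, |x k| ≤ c) (k : ℤ) :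
    |x k| ≤ seqNorm univ x :=
  le_ciSup (f := fun k : (univ : Set ℤ) => |x k|) ⟨c, by rintro _ ⟨k, rfl⟩; exact h k⟩
    ⟨k, mem_univ k⟩

/-! ### The curve and the offsets -/

theorem inner_deriv_normal (v : ℝ → Plane) (t : ℝ) : inner ℝ (deriv v t) (normal v t) = 0 := by
  simp [normal, PiLp.inner_apply, Fin.sum_univ_two]
  ring

theorem periodic_deriv {E : Type*} [NormedAddCommGroup E] [NormedSpace ℝ E] {f : ℝ → E} {c : ℝ}
    (hf : Function.Periodic f c) : Function.Periodic (deriv f) c := fun t => by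
  rw [← deriv_comp_add_const, show (fun x => f (x + c)) = f from funext hf]

theorem exists_norm_le_of_periodic {E : Type*} [NormedAddCommGroup E] {f : ℝ → E} {c : ℝ}
    (hf : Function.Periodic f c) (hc : c ≠ 0) (hcont : Continuous f) : ∃ M, ∀ t, ‖f t‖ ≤ M := by
  obtain ⟨M, hM⟩ := (hf.isBounded_of_continuous hc hcont).exists_norm_le
  exact ⟨M, fun t => hM _ (mem_range_self t)⟩

/-- On a unit speed curve the tangential coordinate agrees with arc length up to a cubic error:
the derivative of the difference is `⟪v' t, v' a⟫ - 1 = -‖v' t - v' a‖² / 2`. -/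
theorem abs_inner_deriv_sub_le {v : ℝ → Plane} {M : ℝ} (hunit : ∀ t, ‖deriv v t‖ = 1)
    (hd : Differentiable ℝ v) (hd' : Differentiable ℝ (deriv v))
    (hM : ∀ t, ‖deriv (deriv v) t‖ ≤ M) (a t : ℝ) :
    |(inner ℝ (v t) (deriv v a) - t) - (inner ℝ (v a) (deriv v a) - a)| ≤
      M ^ 2 / 2 * |t - a| ^ 3 := by
  have hM0 : 0 ≤ M := (norm_nonneg _).trans (hM 0)
  have hder : ∀ u, HasDerivAt (fun u => inner ℝ (v u) (deriv v a) - u)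
      (inner ℝ (deriv v u) (deriv v a) - 1) u := fun u => by
    have h := (hd u).hasDerivAt.inner ℝ (hasDerivAt_const u (deriv v a))
    simp only [inner_zero_right, zero_add] at h
    exact h.sub (hasDerivAt_id u)
  have hbound : ∀ u ∈ uIcc a t, ‖inner ℝ (deriv v u) (deriv v a) - 1‖ ≤
      M ^ 2 / 2 * |t - a| ^ 2 := fun u hu => by
    have h1 : ‖deriv v u - deriv v a‖ ≤ M * ‖u - a‖ :=
      convex_univ.norm_image_sub_le_of_norm_deriv_le (fun x _ => hd' x) (fun x _ => hM x)
        (mem_univ a) (mem_univ u)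
    have h2 : ‖u - a‖ ≤ |t - a| := by
      exact abs_sub_left_of_mem_uIcc hu
    have h3 := norm_sub_sq_real (deriv v u) (deriv v a)
    rw [hunit, hunit] at h3
    have h4 : ‖deriv v u - deriv v a‖ ^ 2 ≤ (M * |t - a|) ^ 2 := by
      gcongr
      exact h1.trans (by gcongr)
    rw [show inner ℝ (deriv v u) (deriv v a) - 1 = -(‖deriv v u - deriv v a‖ ^ 2 / 2) by
      linarith, norm_neg, Real.norm_eq_abs, abs_of_nonneg (by positivity)]
    rw [mul_pow] at h4
    linarith
  have h := (convex_uIcc a t).norm_image_sub_le_of_norm_hasDerivWithin_le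
    (fun u _ => (hder u).hasDerivWithinAt) hbound left_mem_uIcc right_mem_uIcc
  rw [Real.norm_eq_abs, Real.norm_eq_abs] at h
  refine h.trans_eq ?_
  ring

/-- If the new point lies on the normal at `a` through the subdivided point, and all parameters
involved are within `R` of `a`, then subdivision predicts the new arc length up to `O(R ^ 3)`:
pair the defining relation with the tangent at `a`, which annihilates the normal. -/
theorem abs_sub_subdiv_le {v : ℝ → Plane} {M : ℝ} (hunit : ∀ t, ‖deriv v t‖ = 1)
    (hd : Differentiable ℝ v) (hd' : Differentiable ℝ (deriv v))
    (hM : ∀ t, ‖deriv (deriv v) t‖ ≤ M) {p : ℕ} {s : ℤ → ℝ} {K : ℤ} {a b c R : ℝ}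
    (hs : ∀ k, K / 2 ≤ k → k ≤ (K + p) / 2 → |s k - a| ≤ R) (hb : |b - a| ≤ R)
    (hstep : v b = subdiv p (fun i => v (s i)) K + c • normal v a) :
    |b - subdiv p s K| ≤ M ^ 2 * R ^ 3 := by
  set T := deriv v a
  set e : ℝ → ℝ := fun t => (inner ℝ (v t) T - t) - (inner ℝ (v a) T - a) with he
  have hle : ∀ t, |t - a| ≤ R → |e t| ≤ M ^ 2 / 2 * R ^ 3 := fun t ht =>
    (abs_inner_deriv_sub_le hunit hd hd' hM a t).trans (by gcongr)
  have h1 : inner ℝ (v b) T = subdiv p (fun i => inner ℝ (v (s i)) T) K := by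
    have h2 := subdiv_map (innerₛₗ ℝ T) p (fun i => v (s i)) K
    simp only [innerₛₗ_apply_apply] at h2
    simp only [fun x : Plane => real_inner_comm T x]
    rw [h2, hstep, inner_add_right, inner_smul_right, inner_deriv_normal, mul_zero, add_zero]
  have h2 : subdiv p (fun i => e (s i)) K =
      (subdiv p (fun i => inner ℝ (v (s i)) T) K - subdiv p s K) - (inner ℝ (v a) T - a) := by
    rw [he, subdiv_sub, subdiv_sub, subdiv_const]
  have h3 : b - subdiv p s K = subdiv p (fun i => e (s i)) K - e b := by
    rw [h2, ← h1]
    ring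
  rw [h3]
  have h4 := abs_subdiv_le (x := fun i => e (s i)) (K := K) (p := p) fun k hk hk' =>
    hle _ (hs k hk hk')
  exact (abs_sub _ _).trans (by linarith [hle b hb])

/-! ### Step sizes -/

/-- A null sequence with `a (j + 1) ≤ a j / 2 + D * a j ^ 3` is `O(2 ^ (-j))`. It eventually decays
geometrically, hence is square summable, and `2 ^ j * a j` grows in each step at most by the factor
`1 + 2 * D * a j ^ 2 ≤ exp (2 * D * a j ^ 2)`. -/
theorem exists_le_half_pow {a : ℕ → ℝ} {D : ℝ} (hD : 0 ≤ D) (ha : ∀ j, 0 ≤ a j)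
    (hlim : Tendsto a atTop (𝓝 0)) (hrec : ∀ j, a (j + 1) ≤ 1 / 2 * a j + D * a j ^ 3) :
    ∃ B, ∀ j, a j ≤ B * (1 / 2) ^ j := by
  have hsum : Summable fun j => a j ^ 2 := by
    refine summable_of_ratio_norm_eventually_le (r := (3 / 4) ^ 2) (by norm_num) ?_
    have h1 : Tendsto (fun j => D * a j ^ 2) atTop (𝓝 0) := by
      simpa using (hlim.pow 2).const_mul D
    filter_upwards [h1.eventually (gt_mem_nhds (show (0 : ℝ) < 1 / 4 by norm_num))] with j hj
    have h2 : a (j + 1) ≤ 3 / 4 * a j := by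
      have := mul_le_mul_of_nonneg_right hj.le (ha j)
      linarith [hrec j, show D * a j ^ 3 = D * a j ^ 2 * a j by ring]
    rw [norm_pow, norm_pow, ← mul_pow, Real.norm_eq_abs, Real.norm_eq_abs, abs_of_nonneg (ha j),
      abs_of_nonneg (ha _)]
    have := ha (j + 1)
    gcongr
  have key : ∀ j, a j ≤ a 0 * Real.exp (2 * D * ∑ i ∈ Finset.range j, a i ^ 2) * (1 / 2) ^ j := by
    intro j
    induction j with
    | zero => simp
    | succ j ih =>
      have h1 : a (j + 1) ≤ 1 / 2 * a j * Real.exp (2 * D * a j ^ 2) := by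
        have := mul_le_mul_of_nonneg_left (Real.add_one_le_exp (2 * D * a j ^ 2))
          (show 0 ≤ 1 / 2 * a j by linarith [ha j])
        linarith [hrec j, show 1 / 2 * a j * (2 * D * a j ^ 2 + 1) = 1 / 2 * a j + D * a j ^ 3 by
          ring]
      rw [Finset.sum_range_succ, mul_add, Real.exp_add]
      calc _ ≤ _ := h1
        _ ≤ 1 / 2 * (a 0 * Real.exp (2 * D * ∑ i ∈ Finset.range j, a i ^ 2) * (1 / 2) ^ j) *
            Real.exp (2 * D * a j ^ 2) := by gcongr
        _ = _ := by ring
  refine ⟨a 0 * Real.exp (2 * D * ∑' i, a i ^ 2), fun j => (key j).trans ?_⟩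
  have := ha 0
  gcongr
  exact hsum.sum_le_tsum _ fun i _ => sq_nonneg _

theorem interpolant_dyadic {E : Type*} [AddCommGroup E] [Module ℝ E] {m j : ℕ} (hmj : m ≤ j)
    (x : ℤ → E) (i : ℤ) : interpolant j x (i / 2 ^ m) = x (i * 2 ^ (j - m)) := by
  have h : (2 : ℝ) ^ j * (i / 2 ^ m) = ((i * 2 ^ (j - m) : ℤ) : ℝ) := by
    push_cast
    rw [pow_sub₀ _ two_ne_zero hmj]
    ring
  rw [interpolant, h, Int.fract_intCast, Int.floor_intCast]
  simp

theorem interpolant_eq {E : Type*} [AddCommGroup E] [Module ℝ E] (j : ℕ) (x : ℤ → E) (t : ℝ) :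
    interpolant j x t = x ⌊2 ^ j * t⌋ +
      Int.fract (2 ^ j * t) • (x (⌊2 ^ j * t⌋ + 1) - x ⌊2 ^ j * t⌋) := by
  rw [interpolant, sub_smul, one_smul, smul_sub]
  abel

namespace IsWellPosedTransform

variable {p : ℕ} {v : ℝ → Plane} {L : ℝ} {N : ℕ} {nhat : ℕ → ℤ → Plane} {d : ℕ → ℤ → ℝ}
  {s : ℕ → ℤ → ℝ}

theorem fdiff_pos (h : IsWellPosedTransform p v L N nhat d s) (j : ℕ) (k : ℤ) :
    0 < fdiff (s j) k :=
  sub_pos.2 (h.strictMono j (lt_add_one k))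

theorem one_le_period (h : IsWellPosedTransform p v L N nhat d s) (j : ℕ) :
    1 ≤ (2 : ℤ) ^ j * N := by
  have h1 := h.one_le
  have : 0 < (2 : ℤ) ^ j * N := by positivity
  omega

theorem abs_fdiff_le (h : IsWellPosedTransform p v L N nhat d s) (j : ℕ) (k : ℤ) :
    |fdiff (s j) k| ≤ L := by
  have h1 := (h.strictMono j).monotone
    (show k + 1 ≤ k + 2 ^ j * N by linarith [h.one_le_period j])
  rw [h.cyclic] at h1
  rw [abs_of_pos (h.fdiff_pos j k), fdiff]
  linarith

theorem abs_fdiff_le_seqNorm (h : IsWellPosedTransform p v L N nhat d s) (j : ℕ) (k : ℤ) :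
    |fdiff (s j) k| ≤ seqNorm univ (fdiff (s j)) :=
  abs_le_seqNorm (h.abs_fdiff_le j) k

theorem seqNorm_nonneg (h : IsWellPosedTransform p v L N nhat d s) (j : ℕ) :
    0 ≤ seqNorm univ (fdiff (s j)) :=
  (abs_nonneg _).trans (h.abs_fdiff_le_seqNorm j 0)

theorem periodic_fdiff (h : IsWellPosedTransform p v L N nhat d s) (j : ℕ) :
    Function.Periodic (fdiff (s j)) (2 ^ j * N) := fun k => by
  rw [fdiff, fdiff, add_right_comm, h.cyclic, h.cyclic]
  ring

/-- The `2 ^ j * N` steps of a period add up to the length of the curve. -/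
theorem length_le (h : IsWellPosedTransform p v L N nhat d s) (j : ℕ) :
    L ≤ seqNorm univ (fdiff (s j)) * (2 ^ j * N) := by
  have h1 := abs_sub_sub_mul_le (x := s j) (c := 0) (a := 0) (b := 0 + 2 ^ j * N)
    (by linarith [h.one_le_period j])
    fun k _ _ => (by simpa using h.abs_fdiff_le_seqNorm j k)
  rw [h.cyclic] at h1
  have h2 := le_of_abs_le h1
  push_cast at h2
  linarith

/-- Since the arc-length sequences are increasing, pointwise convergence to a continuous limit
forces the step sizes to tend to zero uniformly: every step lies within a cell of a fixed dyadic
grid, and at the finitely many grid points of a period the convergence is uniform. -/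
theorem tendsto_seqNorm_fdiff (h : IsWellPosedTransform p v L N nhat d s) {σ : ℝ → ℝ}
    (hσ : ConvergesTo s σ) : Tendsto (fun j => seqNorm univ (fdiff (s j))) atTop (𝓝 0) := by
  rw [Metric.tendsto_atTop']
  intro ε hε
  have huc := isCompact_Icc.uniformContinuousOn_of_continuous
    (hσ.continuous.continuousOn (s := Icc 0 (N : ℝ)))
  obtain ⟨η, hη, hη'⟩ := Metric.uniformContinuousOn_iff.1 huc (ε / 4) (by positivity)
  obtain ⟨m, hm⟩ := exists_pow_lt_of_lt_one hη (show (1 / 2 : ℝ) < 1 by norm_num)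
  have hev : ∀ᶠ j in atTop, ∀ i ∈ Finset.Icc (0 : ℤ) (2 ^ m * N),
      dist (interpolant j (s j) (i / 2 ^ m)) (σ (i / 2 ^ m)) < ε / 4 :=
    (Filter.eventually_all_finset _).2 fun i _ =>
      (hσ.tendsto _).eventually (Metric.ball_mem_nhds _ (by positivity))
  obtain ⟨J, hJ⟩ := eventually_atTop.1 (hev.and (eventually_ge_atTop m))
  refine ⟨J, fun j hj => ?_⟩
  obtain ⟨hj1, hmj⟩ := hJ j hj.le
  rw [Real.dist_eq, sub_zero, abs_of_nonneg (h.seqNorm_nonneg j)]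
  refine (seqNorm_le univ_nonempty (c := 3 / 4 * ε) fun k _ => ?_).trans_lt (by linarith)
  set P : ℤ := 2 ^ j * N with hP
  have hP0 : 0 < P := by linarith [h.one_le_period j]
  have hk : fdiff (s j) k = fdiff (s j) (k % P) := by
    have h1 := (h.periodic_fdiff j).sub_zsmul_eq (x := k) (k / P)
    rw [smul_eq_mul, ← hP, mul_comm, ← Int.emod_def] at h1
    exact h1.symm
  rw [hk, abs_of_pos (h.fdiff_pos j _)]
  have hk0 := Int.emod_nonneg k hP0.ne'
  have hkP := Int.emod_lt_of_pos k hP0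
  generalize k % P = k at hk0 hkP
  -- the cell `[i * Q, (i + 1) * Q]` of the coarse grid containing `[k, k + 1]`
  set Q : ℤ := 2 ^ (j - m) with hQ
  have hQ0 : 0 < Q := by positivity
  set i : ℤ := k / Q
  have hi0 : 0 ≤ i := Int.ediv_nonneg hk0 hQ0.le
  have hPQ : P = 2 ^ m * N * Q := by
    rw [hP, hQ, ← Nat.add_sub_cancel' hmj, pow_add, Nat.add_sub_cancel_left]
    ring
  have hi1 : i + 1 ≤ 2 ^ m * N := by
    have : i < 2 ^ m * N := Int.ediv_lt_of_lt_mul hQ0 (by rwa [← hPQ])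
    omega
  have hik : i * Q ≤ k := Int.ediv_mul_le k hQ0.ne'
  have hki : k + 1 ≤ (i + 1) * Q := Int.lt_ediv_add_one_mul_self k hQ0
  have e1 := hj1 i (Finset.mem_Icc.2 ⟨hi0, by omega⟩)
  have e2 := hj1 (i + 1) (Finset.mem_Icc.2 ⟨by omega, hi1⟩)
  rw [interpolant_dyadic hmj, Real.dist_eq, abs_lt] at e1 e2
  have hi0' : (0 : ℝ) ≤ i := by exact_mod_cast hi0
  have hi1' : (i : ℝ) + 1 ≤ 2 ^ m * N := by exact_mod_cast hi1
  have hm0 : (0 : ℝ) < 2 ^ m := by positivity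
  have e3 := hη' (((i + 1 : ℤ) : ℝ) / 2 ^ m)
    ⟨by push_cast; positivity, by push_cast; rw [div_le_iff₀ hm0]; linarith⟩
    ((i : ℝ) / 2 ^ m) ⟨by positivity, by rw [div_le_iff₀ hm0]; linarith⟩ (by
      rw [Real.dist_eq, ← sub_div]
      push_cast
      rw [add_sub_cancel_left, abs_of_pos (by positivity), ← one_div_pow]
      exact hm)
  rw [Real.dist_eq, abs_lt] at e3
  have m1 := (h.strictMono j).monotone hik
  have m2 := (h.strictMono j).monotone hki
  rw [fdiff]
  linarith

end IsWellPosedTransform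

end NormalMT

/-! ### The normal re-parametrization -/

open NormalMT in
theorem theorem3p1 (v : ℝ → NormalMT.Plane) (L : ℝ) (hv : NormalMT.IsClosedCurve v L)
    (hv3 : ContDiff ℝ 3 v) (C₁ : ℝ) :
    ∃ C : ℝ, 0 < C ∧
      ∀ (p : ℕ), 3 ≤ p →
      ∀ (N : ℕ) (nhat : ℕ → ℤ → NormalMT.Plane) (d : ℕ → ℤ → ℝ) (s ξ : ℕ → ℤ → ℝ) (σ : ℝ → ℝ),
        (∀ j, NormalMT.ApproxNormals p v C₁ (s j) (nhat (j + 1)) (ξ (j + 1))) →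
        (∀ j, NormalMT.NewPointsLocal p C₁ (s j) (s (j + 1)) (ξ (j + 1))) →
        NormalMT.IsWellPosedTransform p v L N nhat d s →
        NormalMT.ConvergesTo s σ →
        -- cubic decay of the offsets
        (∀ j, NormalMT.seqNorm Set.univ (NormalMT.offset p s j) ≤
          C * NormalMT.seqNorm Set.univ (NormalMT.fdiff (s j)) ^ 3) ∧
        -- the step sizes are comparable to `2 ^ (-j)`
        (∃ c c' : ℝ, 0 < c ∧ 0 < c' ∧ ∀ j : ℕ,
          c * (1 / 2) ^ j ≤ NormalMT.seqNorm Set.univ (NormalMT.fdiff (s j)) ∧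
          NormalMT.seqNorm Set.univ (NormalMT.fdiff (s j)) ≤ c' * (1 / 2) ^ j) ∧
        -- the normal re-parametrization is the limit of the polygonal interpolants, and it is
        -- of class `C^{2,α}` for all `α < 1`, as is its arc-length function
        ∃ γ : ℝ → NormalMT.Plane,
          (∀ t, Tendsto (fun j => NormalMT.interpolant j (fun i => v (s j i)) t) atTop
            (𝓝 (γ t))) ∧
          (∀ t, γ t = v (σ t)) ∧
          ∀ α : ℝ≥0, 0 < α → α < 1 →
            NormalMT.IsHolder 2 α γ ∧ NormalMT.IsHolder 2 α σ := by
  have hd0 : Differentiable ℝ v := hv3.differentiable (by norm_num)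
  have hv2 : ContDiff ℝ 2 (deriv v) :=
    (contDiff_succ_iff_deriv (n := 2).1 (by exact_mod_cast hv3)).2.2
  have hd1 : Differentiable ℝ (deriv v) := hv2.differentiable (by norm_num)
  have hv1 : ContDiff ℝ 1 (deriv (deriv v)) :=
    (contDiff_succ_iff_deriv (n := 1).1 (by exact_mod_cast hv2)).2.2
  have hd2 : Differentiable ℝ (deriv (deriv v)) := hv1.differentiable (by norm_num)
  have hper2 := periodic_deriv (periodic_deriv hv.periodic)
  obtain ⟨M, hM⟩ := exists_norm_le_of_periodic hper2 hv.length_pos.ne' hd2.continuous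
  obtain ⟨M', hM'⟩ := exists_norm_le_of_periodic (periodic_deriv hper2) hv.length_pos.ne'
    (contDiff_one_iff_deriv.1 hv1).2
  -- the summand `1` only makes the constant positive
  refine ⟨M ^ 2 * |C₁| ^ 3 + 1, by positivity, ?_⟩
  set C : ℝ := M ^ 2 * |C₁| ^ 3 + 1
  have hC : 0 ≤ C := by positivity
  intro p hp N nhat d s ξ σ hnhat hnew hs hσ
  set δ : ℕ → ℝ := fun j => seqNorm univ (fdiff (s j))
  have hδ0 : ∀ j, 0 ≤ δ j := hs.seqNorm_nonneg
  have hN : (0 : ℝ) < N := by exact_mod_cast hs.one_le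
  have hoff : ∀ j K, |offset p s j K| ≤ C * δ j ^ 3 := by
    intro j K
    have hR : C₁ * seqNorm (nbhd p (K / 2)) (fdiff (s j)) ≤ |C₁| * δ j := by
      have hne : (nbhd p (K / 2)).Nonempty := ⟨K / 2, by simp only [nbhd, mem_Icc]; omega⟩
      have h0 : 0 ≤ seqNorm (nbhd p (K / 2)) (fdiff (s j)) :=
        Real.iSup_nonneg fun _ => abs_nonneg _
      exact mul_le_mul (le_abs_self _)
        (seqNorm_le hne fun k _ => hs.abs_fdiff_le_seqNorm j k) h0 (abs_nonneg _)
    have hK : K ∈ nbhd p (2 * (K / 2)) ∪ nbhd p (2 * (K / 2) + 1) :=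
      Or.inl (by simp only [nbhd, mem_Icc]; omega)
    obtain ⟨hn, hξ⟩ := hnhat j (K / 2) K hK
    have h1 := abs_sub_subdiv_le hv.unit_speed hd0 hd1 hM (p := p) (s := s j) (K := K)
      (a := ξ (j + 1) K) (b := s (j + 1) K) (c := d (j + 1) K) (R := |C₁| * δ j)
      (fun k hk hk' => by
        rw [abs_sub_comm]
        exact (hξ k (by simp only [nbhd, mem_Icc]; omega)).trans hR)
      ((hnew j (K / 2) K hK).trans hR) (by rw [← hn]; exact hs.step j K)
    refine h1.trans ?_
    have : 0 ≤ δ j ^ 3 := pow_nonneg (hδ0 j) 3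
    rw [mul_pow, ← mul_assoc, add_mul, one_mul]
    linarith
  have hδlim : Tendsto δ atTop (𝓝 0) := hs.tendsto_seqNorm_fdiff hσ
  have hrec : ∀ j, δ (j + 1) ≤ 1 / 2 * δ j + 2 * C * δ j ^ 3 := by
    intro j
    refine seqNorm_le univ_nonempty fun k _ => ?_
    obtain ⟨q, rfl⟩ : ∃ q, p = q + 1 := ⟨p - 1, by omega⟩
    have h1 : fdiff (s (j + 1)) k = 2⁻¹ * subdiv q (fdiff (s j)) k +
        (offset (q + 1) s j (k + 1) - offset (q + 1) s j k) := by
      rw [← fdiff_subdiv_succ]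
      simp only [fdiff, offset]
      ring
    have h2 := abs_subdiv_le (K := k) (p := q) fun k _ _ => hs.abs_fdiff_le_seqNorm j k
    have h3 := hoff j k
    have h4 := hoff j (k + 1)
    change _ ≤ δ j at h2
    rw [h1]
    rw [abs_le] at h2 h3 h4 ⊢
    constructor <;> linarith
  obtain ⟨B, hB⟩ := exists_le_half_pow (by positivity) hδ0 hδlim hrec
  have hB0 : 0 ≤ B := by simpa using (hδ0 0).trans (hB 0)
  refine ⟨fun j => seqNorm_le univ_nonempty fun K _ => hoff j K,
    ⟨L / N, B + 1, div_pos hv.length_pos hN, by positivity, fun j => ⟨?_, ?_⟩⟩, ?_⟩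
  · have h1 := hs.length_le j
    rw [one_div_pow, div_mul_div_comm, mul_one, div_le_iff₀ (by positivity), mul_comm (N : ℝ)]
    exact h1
  · exact (hB j).trans (by gcongr; linarith)
  have hlin : NearlySubdiv p s (C * B ^ 3) (1 / 8) := fun j K => by
    refine (hoff j K).trans ?_
    have h1 : δ j ^ 3 ≤ (B * (1 / 2) ^ j) ^ 3 := pow_le_pow_left₀ (hδ0 j) (hB j) 3
    calc _ ≤ C * (B * (1 / 2) ^ j) ^ 3 := by gcongr
      _ = C * B ^ 3 * (1 / 8) ^ j := by
        rw [mul_pow, ← mul_assoc, pow_right_comm]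
        norm_num
  have hstep : ∀ t, Tendsto (fun j => fdiff (s j) ⌊(2 : ℝ) ^ j * t⌋) atTop (𝓝 0) := fun t =>
    squeeze_zero_norm (fun j => hs.abs_fdiff_le_seqNorm j _) hδlim
  have hfract : ∀ t : ℝ, ∀ j : ℕ, ‖Int.fract ((2 : ℝ) ^ j * t)‖ ≤ 1 := fun t j => by
    rw [Real.norm_eq_abs, abs_of_nonneg (Int.fract_nonneg _)]
    exact (Int.fract_lt_one _).le
  have hfloor : ∀ t, Tendsto (fun j => s j ⌊(2 : ℝ) ^ j * t⌋) atTop (𝓝 (σ t)) := fun t => by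
    have h1 : Tendsto (fun j => Int.fract ((2 : ℝ) ^ j * t) • fdiff (s j) ⌊(2 : ℝ) ^ j * t⌋) atTop
        (𝓝 0) :=
      squeeze_zero_norm (fun j => by
        rw [norm_smul]
        exact mul_le_of_le_one_left (norm_nonneg _) (hfract t j))
        (tendsto_zero_iff_norm_tendsto_zero.1 (hstep t))
    simpa [interpolant_eq, fdiff] using (hσ.tendsto t).sub h1
  refine ⟨fun t => v (σ t), fun t => ?_, fun _ => rfl, fun α hα hα1 => ?_⟩
  · have h1 : Tendsto (fun j => s j (⌊(2 : ℝ) ^ j * t⌋ + 1)) atTop (𝓝 (σ t)) := by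
      simpa [fdiff] using (hfloor t).add (hstep t)
    have h2 := (hd0.continuous.tendsto (σ t)).comp (hfloor t)
    have h3 := ((hd0.continuous.tendsto (σ t)).comp h1).sub h2
    rw [sub_self] at h3
    have h4 := h2.add (squeeze_zero_norm (f := fun j : ℕ => Int.fract ((2 : ℝ) ^ j * t) •
      (v (s j (⌊(2 : ℝ) ^ j * t⌋ + 1)) - v (s j ⌊(2 : ℝ) ^ j * t⌋))) (fun j => by
        rw [norm_smul]
        exact mul_le_of_le_one_left (norm_nonneg _) (hfract t j))
      (tendsto_zero_iff_norm_tendsto_zero.1 h3))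
    rw [add_zero] at h4
    simpa only [interpolant_eq, Function.comp_apply] using h4
  obtain ⟨σ', σ'', hσ', hσ'', ⟨D, hD⟩, hHol⟩ := hlin.exists_hasDerivAt hp (hs.abs_fdiff_le 0)
    hfloor (α := α) hα hα1
  refine ⟨?_, isHolder_two hα hσ' hσ'' hHol⟩
  have c0 : ∀ t, HasDerivAt (fun t => v (σ t)) (σ' t • deriv v (σ t)) t := fun t =>
    (hd0 _).hasDerivAt.scomp t (hσ' t)
  have c1 : ∀ t, HasDerivAt (fun t => deriv v (σ t)) (σ' t • deriv (deriv v) (σ t)) t := fun t =>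
    (hd1 _).hasDerivAt.scomp t (hσ' t)
  have c2 : ∀ t, HasDerivAt (fun t => deriv (deriv v) (σ t))
      (σ' t • deriv (deriv (deriv v)) (σ t)) t := fun t =>
    (hd2 _).hasDerivAt.scomp t (hσ' t)
  have hD0 : 0 ≤ D := (abs_nonneg _).trans (hD 0)
  have b0 : BddHolder α σ' := by
    obtain ⟨E, -, hE, -⟩ := id hHol
    exact .of_hasDerivAt hα1.le hD hσ'' hE
  have b1 : BddHolder α fun t => deriv v (σ t) :=
    .of_hasDerivAt hα1.le (fun t => (hv.unit_speed _).le) c1 (B := D * M) fun t => by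
      rw [norm_smul]
      exact mul_le_mul (hD t) (hM _) (norm_nonneg _) hD0
  have b2 : BddHolder α fun t => deriv (deriv v) (σ t) :=
    .of_hasDerivAt hα1.le (fun t => hM _) c2 (B := D * M') fun t => by
      rw [norm_smul]
      exact mul_le_mul (hD t) (hM' _) (norm_nonneg _) hD0
  exact isHolder_two hα c0 (fun t => (hσ'' t).fun_smul (c1 t))
    ((b0.smul (b0.smul b2)).add (hHol.smul b1))
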